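/- Let $r = 2^{-1/2}$, and let $(s,c)$ be the solution on the open disc $B_r(0) \subset \mathbb{C}$ of the initial value problem $$s' = c\,(1+s^2), \quad c' = -s\,(1+c^2); \qquad s(0)=0, \quad c(0)=1 .$$ This solution exists and is unique on $B_r(0)$; its component $s$ extends uniquely to a meromorphic function on $\mathbb{C}$, still denoted by $s$ (the full lemniscatic sine), and there is a unique $L \in [0, \tfrac{1}{2}\pi]$ with $s(L) = 1$. Define $C(z) = s(L - z)$ for all $z \in \mathbb{C}$ such that $L - z$ is not a pole of $s$. Then: 1. $C$ is meromorphic on $\mathbb{C}$. 2. The restriction of $C$ to $B_r(0)$ is the original solution component $c$. Moreover, $C'' = -2C^3$ holds at every point that is not a pole of $C$, $C(0)=1$ and $C'(0)=0$; on $B_r(0)$ both $C$ and $c$ are holomorphic solutions of the second-order initial value problem $$f'' = -2f^3; \qquad f(0)=1, \quad f'(0)=0,$$ and this problem has only one holomorphic solution on $B_r(0)$. 3. $C$ (the full lemniscatic cosine, denoted again by $c$) is elliptic: $4L$ and $4iL$ are periods of $C$, and they are linearly independent over $\mathbb{R}$. 4. The poles of $C$ are precisely the points $\pm iL$ and $2L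 \pm iL$ and the points congruent to these modulo the periods $4L$ and $4iL$, that is, the points $p + 4mL + 4niL$ with $p \in \{iL, -iL, 2L+iL, 2L-iL\}$ and $m, n \in \mathbb{Z}$. -/

import Mathlib

open Set

/-- The open disc `B_r(0)` of radius `r = 2^{-1/2}` about the origin. -/
noncomputable def lemniscaticDisc : Set ℂ := Metric.ball 0 ((2 : ℝ) ^ (-(1 / 2) : ℝ))

/-- `(s, c)` solves the complex system `s' = c (1 + s²)`, `c' = -s (1 + c²)`, `s(0) = 0`, `c(0) = 1`
on the disc `B_r(0)`. (Values outside the disc are irrelevant.) -/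
structure IsLemniscaticIVPSolution (s c : ℂ → ℂ) : Prop where
  s_zero : s 0 = 0
  c_zero : c 0 = 1
  hasDerivAt_s : ∀ z ∈ lemniscaticDisc, HasDerivAt s (c z * (1 + s z ^ 2)) z
  hasDerivAt_c : ∀ z ∈ lemniscaticDisc, HasDerivAt c (-s z * (1 + c z ^ 2)) z

/-- `s` is a meromorphic function on the whole plane that extends the first component of a solution
of the initial value problem on `B_r(0)`. Normal form means that `s` is analytic at every point that
is not a pole and takes the conventional value `0` at its poles. -/
structure IsFullLemniscaticSine (s : ℂ → ℂ) : Prop where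
  meromorphicNFOn : MeromorphicNFOn s univ
  extends_ivp : ∃ s₀ c₀ : ℂ → ℂ, IsLemniscaticIVPSolution s₀ c₀ ∧ EqOn s s₀ lemniscaticDisc

/-- The full lemniscatic sine: the meromorphic extension to the plane of the solution `s` of the
initial value problem. -/
noncomputable def lemniscaticSine : ℂ → ℂ :=
  Classical.epsilon fun s : ℂ → ℂ => IsFullLemniscaticSine s

/-- `L` is a point of `[0, π/2]` at which the lemniscatic sine takes the value `1`. -/
def IsLemniscaticL (L : ℝ) : Prop :=
  L ∈ Icc 0 (Real.pi / 2) ∧ lemniscaticSine (L : ℂ) = 1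

/-- The number `L ∈ [0, π/2]` with `s(L) = 1`. -/
noncomputable def lemniscaticL : ℝ := Classical.epsilon fun L : ℝ => IsLemniscaticL L

/-- The function `C(z) = s(L - z)`. -/
noncomputable def lemniscaticCosine (z : ℂ) : ℂ := lemniscaticSine ((lemniscaticL : ℂ) - z)

/-- `f` is holomorphic on `U` and solves `f'' = -2 f³`, `f(0) = 1`, `f'(0) = 0` there. -/
structure IsSecondOrderSolutionOn (f : ℂ → ℂ) (U : Set ℂ) : Prop where
  differentiableOn : DifferentiableOn ℂ f U
  deriv_deriv : ∀ z ∈ U, deriv (deriv f) z = -2 * f z ^ 3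
  map_zero : f 0 = 1
  deriv_zero : deriv f 0 = 0

/-- `z` is a pole of the meromorphic function `f`. -/
def IsPole (f : ℂ → ℂ) (z : ℂ) : Prop := meromorphicOrderAt f z < 0

/-- `f` is an elliptic function having `ω₁` and `ω₂` as (not necessarily fundamental) periods. -/
structure IsEllipticWithPeriods (f : ℂ → ℂ) (ω₁ ω₂ : ℂ) : Prop where
  meromorphic : Meromorphic f
  linearIndependent : LinearIndependent ℝ ![ω₁, ω₂]
  periodic₁ : Function.Periodic f ω₁
  periodic₂ : Function.Periodic f ω₂

open Filter Topology

/-! Everything is reduced to the equation `f'' = -2 f³`. A germ of a solution is determined by its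
value and first derivative (`SolvesAt.eventuallyEq`), so an identity between meromorphic functions
on the plane follows by matching initial data at one point and applying the identity theorem.

The entire-plane function `S` is obtained by inverting `∫ dw / √(1 - w⁴)` near `0` and repeatedly
doubling the disc with the duplication formula. The equation is invariant under `f ↦ κ f(μ z + b)`
with `κ² = μ²`, which makes `S` odd and gives `S(iz) = i S(z)`. On the real axis `S` is real and
`S'² = 1 - S⁴` bounds it by `1`. Comparison with the arcsine gives a first `L ≤ π/2` with `S(L) =
1`. As `S'(L) = 0`, `S` is symmetric about `L`; together with oddness this gives the antiperiods
`2L` and `2iL`.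

In the addition formula for `x + iy` the denominator is `1 - S(x)² S(y)²`, so a pole forces `S(x)² =
S(y)² = 1`, that is, `x` and `y` are odd multiples of `L`; all these points are poles. The addition
formula at `L` also gives `S'(z) = S(L - z)(1 + S(z)²)`, hence the first-order system. In the other
direction the invariant `(1 + s²)(1 + c²) = 2` turns that system into the second-order equation. -/

/-- `f` is analytic at `a` and solves `f'' = -2 f³` near `a`. -/
def SolvesAt (f : ℂ → ℂ) (a : ℂ) : Prop :=
  AnalyticAt ℂ f a ∧ ∀ᶠ z in 𝓝 a, deriv (deriv f) z = -2 * f z ^ 3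

/-! ### Local theory of `f'' = -2 f³`. -/

namespace SolvesAt

variable {f g : ℂ → ℂ} {a : ℂ}

theorem eventually (h : SolvesAt f a) : ∀ᶠ z in 𝓝 a, SolvesAt f z := by
  filter_upwards [h.1.eventually_analyticAt, h.2.eventually_nhds] with z h1 h2 using ⟨h1, h2⟩

theorem hasDerivAt (h : SolvesAt f a) : HasDerivAt f (deriv f a) a :=
  h.1.differentiableAt.hasDerivAt

theorem hasDerivAt_deriv (h : SolvesAt f a) : HasDerivAt (deriv f) (-2 * f a ^ 3) a := by
  rw [← h.2.self_of_nhds]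
  exact h.1.deriv.differentiableAt.hasDerivAt

theorem of_hasDerivAt {f' : ℂ → ℂ} (h1 : ∀ᶠ z in 𝓝 a, HasDerivAt f (f' z) z)
    (h2 : ∀ᶠ z in 𝓝 a, HasDerivAt f' (-2 * f z ^ 3) z) : SolvesAt f a := by
  refine ⟨?_, ?_⟩
  · rw [Complex.analyticAt_iff_eventually_differentiableAt]
    exact h1.mono fun z hz => hz.differentiableAt
  · filter_upwards [h1.eventually_nhds, h2] with z hz hz2
    have : deriv f =ᶠ[𝓝 z] f' := hz.mono fun w hw => hw.deriv
    rw [this.deriv_eq, hz2.deriv]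

theorem congr (h : SolvesAt f a) (hfg : f =ᶠ[𝓝 a] g) : SolvesAt g a := by
  refine ⟨h.1.congr hfg, ?_⟩
  filter_upwards [h.2, hfg, hfg.deriv.deriv] with z h1 h2 h3
  rw [← h2, ← h3, h1]

/-- Differentiating twice produces the factor `κ μ²`, cubing produces `κ³`; the hypothesis makes
them equal. -/
theorem comp_affine {κ μ b : ℂ} (hκ : κ ^ 2 = μ ^ 2) (h : SolvesAt f (μ * a + b)) :
    SolvesAt (fun z => κ * f (μ * z + b)) a := by
  have hc : Tendsto (fun z : ℂ => μ * z + b) (𝓝 a) (𝓝 (μ * a + b)) := by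
    apply Continuous.tendsto; fun_prop
  have haff (z : ℂ) : HasDerivAt (fun z : ℂ => μ * z + b) μ z := by
    simpa using ((hasDerivAt_id z).const_mul μ).add_const b
  have hev := hc.eventually h.eventually
  refine of_hasDerivAt (f' := fun z => κ * (deriv f (μ * z + b) * μ)) ?_ ?_
  · filter_upwards [hev] with z hz
    exact (hz.hasDerivAt.comp z (haff z)).const_mul κ
  · filter_upwards [hev] with z hz
    refine (((hz.hasDerivAt_deriv.comp z (haff z)).mul_const μ).const_mul κ).congr_deriv ?_
    linear_combination (2 * κ * f (μ * z + b) ^ 3) * hκ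

/-- The difference `h` satisfies a linear equation `h'' = q h` with `q` analytic. If `h` and `h'`
vanish at `a` and `h` has finite order `n`, then `h''` has order `n - 2`, whereas `q h` has order at
least `n`. -/
theorem eventuallyEq (hf : SolvesAt f a) (hg : SolvesAt g a) (h0 : f a = g a)
    (h1 : deriv f a = deriv g a) : f =ᶠ[𝓝 a] g := by
  have hh : AnalyticAt ℂ (f - g) a := hf.1.sub hg.1
  have hd : deriv (f - g) =ᶠ[𝓝 a] deriv f - deriv g := by
    filter_upwards [hf.eventually, hg.eventually] with z h1 h2
    exact (h1.hasDerivAt.sub h2.hasDerivAt).deriv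
  have hdd : deriv (deriv (f - g)) =ᶠ[𝓝 a]
      (fun z => -2 * (f z ^ 2 + f z * g z + g z ^ 2)) * (f - g) := by
    filter_upwards [hf.eventually, hg.eventually, hd.deriv] with z h1 h2 h3
    rw [h3, (h1.hasDerivAt_deriv.sub h2.hasDerivAt_deriv).deriv]
    simp only [Pi.mul_apply, Pi.sub_apply]
    ring
  have hq : AnalyticAt ℂ (fun z => -2 * (f z ^ 2 + f z * g z + g z ^ 2)) a := by
    have := hf.1; have := hg.1; fun_prop
  have e1 := hh.analyticOrderAt_deriv_add_one
  have e2 := hh.deriv.analyticOrderAt_deriv_add_one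
  rw [hd.eq_of_nhds] at e2
  simp only [Pi.sub_apply, h0, h1, sub_self, sub_zero] at e1 e2
  rw [analyticOrderAt_congr hdd, analyticOrderAt_mul hq hh] at e2
  have e3 : analyticOrderAt (f - g) a = ⊤ := by
    have e1' : analyticOrderAt (deriv (f - g)) a + 1 = analyticOrderAt (f - g) a := e1
    have e2' : analyticOrderAt (fun z => -2 * (f z ^ 2 + f z * g z + g z ^ 2)) a
      + analyticOrderAt (f - g) a + 1 = analyticOrderAt (deriv (f - g)) a := e2
    rw [← e2'] at e1'
    generalize analyticOrderAt (f - g) a = n at *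
    generalize analyticOrderAt (fun z => -2 * (f z ^ 2 + f z * g z + g z ^ 2)) a = m at *
    cases n with
    | top => rfl
    | coe n =>
      cases m with
      | top => simp at e1'
      | coe m => norm_cast at e1'; omega
  rw [analyticOrderAt_eq_top] at e3
  filter_upwards [e3] with z hz using sub_eq_zero.1 hz

/-- The energy `f'² + f⁴` has derivative zero. -/
theorem first_integral (h : SolvesAt f a) (h0 : deriv f a ^ 2 = 1 - f a ^ 4) :
    ∀ᶠ z in 𝓝 a, deriv f z ^ 2 = 1 - f z ^ 4 := by
  obtain ⟨ε, hε, hb⟩ := Metric.eventually_nhds_iff_ball.1 h.eventually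
  have hder : ∀ z ∈ Metric.ball a ε, HasDerivAt (fun z => deriv f z ^ 2 + f z ^ 4) 0 z := by
    intro z hz
    refine (((hb z hz).hasDerivAt_deriv.pow 2).add ((hb z hz).hasDerivAt.pow 4)).congr_deriv ?_
    simp only [Nat.cast_ofNat]
    ring
  filter_upwards [Metric.ball_mem_nhds a hε] with z hz
  have := Metric.isOpen_ball.is_const_of_deriv_eq_zero (convex_ball a ε).isPreconnected
    (fun w hw => (hder w hw).differentiableAt.differentiableWithinAt)
    (fun w hw => (hder w hw).deriv) hz (Metric.mem_ball_self hε)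
  linear_combination this + h0

end SolvesAt

/-! ### Identity theorem for meromorphic functions. -/

/-- A meromorphic function on a preconnected set that vanishes near one point vanishes near every
point, except perhaps at the point itself. -/
theorem MeromorphicOn.eventually_nhdsNE_eq_zero {h : ℂ → ℂ} {U : Set ℂ} (hh : MeromorphicOn h U)
    (hU : IsPreconnected U) {a z : ℂ} (ha : a ∈ U) (hz : z ∈ U) (h0 : ∀ᶠ w in 𝓝[≠] a, h w = 0) :
    ∀ᶠ w in 𝓝[≠] z, h w = 0 := by
  rw [← meromorphicOrderAt_eq_top_iff] at h0 ⊢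
  by_contra hne
  exact hh.meromorphicOrderAt_ne_top_of_isPreconnected hU hz ha hne h0

theorem MeromorphicOn.eventuallyEq_nhdsNE {f g : ℂ → ℂ} {U : Set ℂ} (hf : MeromorphicOn f U)
    (hg : MeromorphicOn g U) (hU : IsPreconnected U) {a z : ℂ} (ha : a ∈ U) (hz : z ∈ U)
    (h : f =ᶠ[𝓝 a] g) : f =ᶠ[𝓝[≠] z] g := by
  have := (hf.sub hg).eventually_nhdsNE_eq_zero hU ha hz
    ((h.filter_mono nhdsWithin_le_nhds).mono fun w hw => by simp [hw])
  filter_upwards [this] with w hw using sub_eq_zero.1 hw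

/-- Normal form removes the exceptional points: functions in normal form that agree on a punctured
neighbourhood also agree at its centre, poles included. -/
theorem MeromorphicNFOn.eqOn {f g : ℂ → ℂ} {U : Set ℂ} (hf : MeromorphicNFOn f U)
    (hg : MeromorphicNFOn g U) (hU : IsPreconnected U) {a : ℂ} (ha : a ∈ U)
    (h : f =ᶠ[𝓝 a] g) : EqOn f g U := fun _ hz =>
  (((hf hz).eventuallyEq_nhdsNE_iff_eventuallyEq_nhds (hg hz)).1
    (hf.meromorphicOn.eventuallyEq_nhdsNE hg.meromorphicOn hU ha hz h)).eq_of_nhds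

/-- Two functions that are continuous at `z` and agree near `z` agree at `z`. -/
theorem eq_of_eventuallyEq_nhdsNE {f g : ℂ → ℂ} {z : ℂ} (hf : ContinuousAt f z)
    (hg : ContinuousAt g z) (h : f =ᶠ[𝓝[≠] z] g) : f z = g z :=
  ((hf.eventuallyEq_nhds_iff_eventuallyEq_nhdsNE hg).1 h).eq_of_nhds

/-! ### Construction of the lemniscatic sine on the plane. -/

/-- The local inverse `s` of a primitive `F` of `1 / √(1 - w⁴)` satisfies `s' = √(1 - s⁴)`, and
differentiating once more gives the equation. -/
theorem exists_local_solution : ∃ f : ℂ → ℂ, SolvesAt f 0 ∧ f 0 = 0 ∧ deriv f 0 = 1 := by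
  set q : ℂ → ℂ := fun w => Complex.exp (Complex.log (1 - w ^ 4) / 2) with hq
  have hslit : ∀ w ∈ Metric.ball (0 : ℂ) 1, 1 - w ^ 4 ∈ Complex.slitPlane := by
    intro w hw
    left
    have h1 : ‖w‖ < 1 := by simpa using hw
    have h2 : (w ^ 4).re ≤ ‖w ^ 4‖ := Complex.re_le_norm _
    rw [norm_pow] at h2
    have h3 : ‖w‖ ^ 4 < 1 := pow_lt_one₀ (norm_nonneg _) h1 (by norm_num)
    simp only [Complex.sub_re, Complex.one_re]
    linarith
  have hqd : DifferentiableOn ℂ q (Metric.ball 0 1) := by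
    intro w hw
    have := hslit w hw
    apply DifferentiableAt.differentiableWithinAt
    have h1 : DifferentiableAt ℂ (fun w : ℂ => Complex.log (1 - w ^ 4)) w :=
      DifferentiableAt.clog (by fun_prop) this
    fun_prop
  have hq2 : ∀ w ∈ Metric.ball (0 : ℂ) 1, q w ^ 2 = 1 - w ^ 4 := by
    intro w hw
    have := Complex.slitPlane_ne_zero (hslit w hw)
    simp only [hq, ← Complex.exp_nat_mul]
    rw [show ((2 : ℕ) : ℂ) * (Complex.log (1 - w ^ 4) / 2) = Complex.log (1 - w ^ 4) by
      push_cast; ring, Complex.exp_log this]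
  have hqne (w : ℂ) : q w ≠ 0 := Complex.exp_ne_zero _
  have hq0 : q 0 = 1 := by simp [hq]
  obtain ⟨F₀, hF₀⟩ := (hqd.inv fun w _ => hqne w).isExactOn_ball
  have hF : ∀ w ∈ Metric.ball (0 : ℂ) 1, HasDerivAt (fun w => F₀ w - F₀ 0) (q w)⁻¹ w := by
    intro w hw
    exact (hF₀ w hw).sub_const _
  set F : ℂ → ℂ := fun w => F₀ w - F₀ 0
  have hF0 : F 0 = 0 := sub_self _
  have hb : Metric.ball (0 : ℂ) 1 ∈ 𝓝 (0 : ℂ) := Metric.ball_mem_nhds _ one_pos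
  have hFan : AnalyticAt ℂ F 0 := by
    rw [Complex.analyticAt_iff_eventually_differentiableAt]
    filter_upwards [hb] with w hw using (hF w hw).differentiableAt
  have hF'0 : deriv F 0 = 1 := by
    rw [(hF 0 (Metric.mem_ball_self one_pos)).deriv, hq0, inv_one]
  have hF'ne : deriv F 0 ≠ 0 := by rw [hF'0]; exact one_ne_zero
  set s := hFan.hasStrictDerivAt.localInverse _ _ _ hF'ne with hs
  have hsan : AnalyticAt ℂ s 0 := by
    have := hFan.analyticAt_localInverse hF'ne
    rwa [hF0] at this
  have hright : ∀ᶠ z in 𝓝 (0 : ℂ), F (s z) = z := by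
    have := hFan.hasStrictDerivAt.eventually_right_inverse hF'ne
    rwa [hF0] at this
  have hs0 : s 0 = 0 := by
    have := (hFan.hasStrictDerivAt.eventually_left_inverse hF'ne).self_of_nhds
    rwa [hF0] at this
  have hsball : ∀ᶠ z in 𝓝 (0 : ℂ), s z ∈ Metric.ball (0 : ℂ) 1 := by
    apply hsan.continuousAt.eventually
    rw [hs0]; exact hb
  have hs' : ∀ᶠ z in 𝓝 (0 : ℂ), HasDerivAt s (q (s z)) z := by
    filter_upwards [hright.eventually_nhds, hsball, hsan.eventually_analyticAt] with z h1 h2 h3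
    have h4 := h3.differentiableAt.hasDerivAt
    have h5 := (hF _ h2).comp z h4
    have h6 : HasDerivAt (F ∘ s) 1 z := (hasDerivAt_id z).congr_of_eventuallyEq h1
    have h7 := h5.unique h6
    have : deriv s z = q (s z) := by
      have := hqne (s z)
      field_simp at h7
      exact h7
    rwa [this] at h4
  refine ⟨s, SolvesAt.of_hasDerivAt hs' ?_, hs0, ?_⟩
  · filter_upwards [hs', hsball] with z h1 h2
    have h3 := (hqd.differentiableAt (Metric.isOpen_ball.mem_nhds h2)).hasDerivAt
    have h4 : HasDerivAt (fun w => q w ^ 2) (2 * q (s z) * deriv q (s z)) (s z) :=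
      (h3.fun_pow 2).congr_deriv (by simp)
    have h5 : HasDerivAt (fun w : ℂ => 1 - w ^ 4) (-(4 * s z ^ 3)) (s z) := by
      simpa using ((hasDerivAt_id' (s z)).fun_pow 4).const_sub 1
    -- Differentiating `q² = 1 - w⁴` gives `q q' = -2 w³`, which is the derivative of `q ∘ s` since
    -- `s' = q ∘ s`.
    have h6 := h4.unique (h5.congr_of_eventuallyEq
      (by filter_upwards [Metric.isOpen_ball.mem_nhds h2] with w hw using hq2 w hw))
    refine (h3.comp z h1).congr_deriv ?_
    linear_combination h6 / 2
  · rw [hs'.self_of_nhds.deriv, hs0, hq0]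

/-- The right-hand side `2 f(z/2) f'(z/2) / (1 + f(z/2)⁴)` of the duplication formula of the
lemniscatic sine. -/
noncomputable def duplicate (f : ℂ → ℂ) (z : ℂ) : ℂ :=
  2 * f (z / 2) * deriv f (z / 2) / (1 + f (z / 2) ^ 4)

theorem SolvesAt.duplicate_eventuallyEq {f : ℂ → ℂ} (h : SolvesAt f 0) (h0 : f 0 = 0)
    (h1 : deriv f 0 = 1) : duplicate f =ᶠ[𝓝 0] f := by
  have hI := h.first_integral (by simp [h0, h1])
  have hne : ∀ᶠ z in 𝓝 (0 : ℂ), 1 + f z ^ 4 ≠ 0 := by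
    have : ContinuousAt (fun z => 1 + f z ^ 4) 0 := by have := h.1.continuousAt; fun_prop
    exact this.eventually_ne (by simp [h0])
  -- The function `E = 4 f f' / (1 + f⁴)` is shown to solve the equation; the duplicate is `E(z/2) /
  -- 2`, a rescaling with `κ = μ = 1/2`.
  have hd1 : ∀ᶠ z in 𝓝 (0 : ℂ), HasDerivAt (fun z => 4 * f z * deriv f z / (1 + f z ^ 4))
      (4 * (1 - 6 * f z ^ 4 + f z ^ 8) / (1 + f z ^ 4) ^ 2) z := by
    filter_upwards [h.eventually, hI, hne] with z hz hI hne
    refine (((hz.hasDerivAt.const_mul 4).mul hz.hasDerivAt_deriv).div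
      ((hz.hasDerivAt.fun_pow 4).const_add 1) hne).congr_deriv ?_
    congr 1
    simp only [Nat.cast_ofNat, Pi.mul_apply]
    norm_num
    linear_combination (4 * (1 + f z ^ 4) - 16 * f z ^ 4) * hI
  have hd2 : ∀ᶠ z in 𝓝 (0 : ℂ), HasDerivAt
      (fun z => 4 * (1 - 6 * f z ^ 4 + f z ^ 8) / (1 + f z ^ 4) ^ 2)
      (-2 * (4 * f z * deriv f z / (1 + f z ^ 4)) ^ 3) z := by
    filter_upwards [h.eventually, hI, hne] with z hz hI hne
    refine ((((((hz.hasDerivAt.fun_pow 4).const_mul 6).const_sub 1).add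
      (hz.hasDerivAt.fun_pow 8)).const_mul 4).div
      (((hz.hasDerivAt.fun_pow 4).const_add 1).fun_pow 2) (pow_ne_zero 2 hne)).congr_deriv ?_
    simp only [Nat.cast_ofNat]
    norm_num
    field_simp
    linear_combination (32 * f z ^ 3 * deriv f z) * hI
  have hsol := SolvesAt.of_hasDerivAt hd1 hd2
  have hE : SolvesAt (duplicate f) 0 := by
    have h3 := SolvesAt.comp_affine (κ := 1 / 2) (μ := 1 / 2) (b := 0) (a := 0) rfl
      (by simpa using hsol)
    convert h3 using 1
    funext z
    simp only [duplicate, show 1 / 2 * z + 0 = z / 2 by ring]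
    ring
  refine hE.eventuallyEq h (by simp [duplicate, h0]) ?_
  have h4 := hd1.self_of_nhds
  have h5 : HasDerivAt (fun z : ℂ => z / 2) (1 / 2) 0 := (hasDerivAt_id' 0).div_const 2
  have h6 := (HasDerivAt.comp (0 : ℂ) (by simpa using h4) h5).const_mul (1 / 2)
  rw [h1]
  refine HasDerivAt.deriv ((h6.congr_of_eventuallyEq (.of_forall fun z => ?_)).congr_deriv ?_)
  · simp only [duplicate, Function.comp]; ring
  · simp only [h0]; norm_num

theorem MeromorphicOn.duplicate {f : ℂ → ℂ} {R : ℝ} (hf : MeromorphicOn f (Metric.ball 0 R)) :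
    MeromorphicOn (duplicate f) (Metric.ball 0 (2 * R)) := by
  intro z hz
  have hz2 : z / 2 ∈ Metric.ball (0 : ℂ) R := by
    simp only [mem_ball_zero_iff, norm_div, Complex.norm_ofNat] at hz ⊢
    linarith
  have ha : AnalyticAt ℂ (fun z : ℂ => z / 2) z := by fun_prop
  have h1 : MeromorphicAt (fun z => f (z / 2)) z :=
    MeromorphicAt.comp_analyticAt (g := fun z : ℂ => z / 2) (hf _ hz2) ha
  have h2 : MeromorphicAt (fun z => deriv f (z / 2)) z :=
    MeromorphicAt.comp_analyticAt (g := fun z : ℂ => z / 2) (hf _ hz2).deriv ha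
  exact (((MeromorphicAt.const 2 z).mul h1).mul h2).div
    ((MeromorphicAt.const 1 z).add (h1.pow 4))

/-- A meromorphic function on the plane in normal form that solves `f'' = -2 f³`, `f(0) = 0`,
`f'(0) = 1` near the origin. -/
structure IsSl (S : ℂ → ℂ) : Prop where
  nf : MeromorphicNFOn S univ
  solves : SolvesAt S 0
  map_zero : S 0 = 0
  deriv_zero : deriv S 0 = 1

/-- Duplication carries a meromorphic function from the disc of radius `R` to that of radius `2R`
without changing its germ at `0`. The resulting functions agree on common discs by the identity
theorem, so they glue. -/
theorem exists_isSl : ∃ S, IsSl S := by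
  obtain ⟨s, hs, hs0, hs1⟩ := exists_local_solution
  obtain ⟨ε, hε, hball⟩ := Metric.eventually_nhds_iff_ball.1 hs.eventually
  have hstep : ∀ n : ℕ, ∃ f : ℂ → ℂ, MeromorphicNFOn f (Metric.ball 0 (2 ^ n * ε)) ∧
      f =ᶠ[𝓝 0] s := by
    intro n
    induction n with
    | zero =>
      exact ⟨s, fun z hz => (hball z (by simpa using hz)).1.meromorphicNFAt, .rfl⟩
    | succ n ih =>
      obtain ⟨f, hf, hfs⟩ := ih
      have hm : MeromorphicOn (duplicate f) (Metric.ball 0 (2 ^ (n + 1) * ε)) := by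
        have := hf.meromorphicOn.duplicate
        rwa [← mul_assoc, ← pow_succ'] at this
      have h1 : duplicate f =ᶠ[𝓝 0] s :=
        ((hs.congr hfs.symm).duplicate_eventuallyEq (hfs.eq_of_nhds.trans hs0)
          (hfs.deriv_eq.trans hs1)).trans hfs
      refine ⟨_, meromorphicNFOn_toMeromorphicNFOn (duplicate f) _, ?_⟩
      have h0 : (0 : ℂ) ∈ Metric.ball (0 : ℂ) (2 ^ (n + 1) * ε) :=
        Metric.mem_ball_self (by positivity)
      refine Filter.EventuallyEq.trans ?_ h1
      -- Passing to normal form does not alter the germ at `0`, since the duplicate is already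
      -- analytic there.
      rw [← (meromorphicNFOn_toMeromorphicNFOn (duplicate f) _
        h0).eventuallyEq_nhdsNE_iff_eventuallyEq_nhds (hs.1.congr h1.symm).meromorphicNFAt]
      exact hm.toMeromorphicNFOn_eq_self_on_nhdsNE h0
  choose f hf hfs using hstep
  have hmono : ∀ {m n : ℕ}, m ≤ n → Metric.ball (0 : ℂ) (2 ^ m * ε) ⊆
      Metric.ball 0 (2 ^ n * ε) := fun h =>
    Metric.ball_subset_ball (by gcongr; norm_num)
  have hagree : ∀ {m n : ℕ}, m ≤ n → EqOn (f m) (f n) (Metric.ball 0 (2 ^ m * ε)) := by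
    intro m n hmn
    exact (hf m).eqOn (fun z hz => hf n (hmono hmn hz)) (convex_ball _ _).isPreconnected
      (Metric.mem_ball_self (by positivity)) ((hfs m).trans (hfs n).symm)
  have hex : ∀ z : ℂ, ∃ n : ℕ, z ∈ Metric.ball (0 : ℂ) (2 ^ n * ε) := by
    intro z
    obtain ⟨n, hn⟩ := pow_unbounded_of_one_lt (‖z‖ / ε) (by norm_num : (1 : ℝ) < 2)
    exact ⟨n, by rw [mem_ball_zero_iff]; exact (div_lt_iff₀ hε).1 hn⟩
  choose N hN using hex
  have hS : ∀ n, EqOn (fun z => f (N z) z) (f n) (Metric.ball 0 (2 ^ n * ε)) := by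
    intro n z hz
    rcases le_total (N z) n with h | h
    · exact hagree h (hN z)
    · exact (hagree h hz).symm
  have hS' : ∀ n z, z ∈ Metric.ball (0 : ℂ) (2 ^ n * ε) → (fun z => f (N z) z) =ᶠ[𝓝 z] f n :=
    fun n z hz => by filter_upwards [Metric.isOpen_ball.mem_nhds hz] with w hw using hS n hw
  have hSs : (fun z => f (N z) z) =ᶠ[𝓝 0] s :=
    (hS' 0 0 (Metric.mem_ball_self (by positivity))).trans (hfs 0)
  exact ⟨fun z => f (N z) z,
    fun z _ => (meromorphicNFAt_congr (hS' _ z (hN z))).2 (hf _ (hN z)),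
    hs.congr hSs.symm, hSs.eq_of_nhds.trans hs0, hSs.deriv_eq.trans hs1⟩

/-! ### Global transfer of the equation; affine maps and conjugation. -/

theorem MeromorphicNFOn.comp_affine {f : ℂ → ℂ} (hf : MeromorphicNFOn f univ) {κ : ℂ} (μ b : ℂ)
    (hκ : κ ≠ 0) : MeromorphicNFOn (fun z => κ * f (μ * z + b)) univ := by
  intro z _
  have h1 : MeromorphicNFAt (f ∘ fun z => μ * z + b) z :=
    (hf (mem_univ (μ * z + b))).comp_analyticAt (g := fun z => μ * z + b) (by fun_prop)
  exact (meromorphicNFAt_mul_iff_right (g := fun _ => κ) analyticAt_const hκ).2 h1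

theorem MeromorphicNFOn.eq_of_solvesAt {f g : ℂ → ℂ} (hf : MeromorphicNFOn f univ)
    (hg : MeromorphicNFOn g univ) {a : ℂ} (hfa : SolvesAt f a) (hga : SolvesAt g a)
    (h0 : f a = g a) (h1 : deriv f a = deriv g a) : f = g :=
  funext fun z => hf.eqOn hg isPreconnected_univ (mem_univ a) (hfa.eventuallyEq hga h0 h1)
    (mem_univ z)

theorem deriv_affine (f : ℂ → ℂ) (κ μ b z : ℂ) :
    deriv (fun z => κ * f (μ * z + b)) z = κ * (μ * deriv f (μ * z + b)) := by
  rw [deriv_const_mul_field]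
  congr 1
  have h1 := deriv_comp_mul_left μ (fun w => f (w + b)) z
  simp only [deriv_comp_add_const, smul_eq_mul] at h1
  exact h1

theorem Meromorphic.solvesAt {f : ℂ → ℂ} (hf : Meromorphic f) {a z : ℂ} (ha : SolvesAt f a)
    (hz : AnalyticAt ℂ f z) : SolvesAt f z := by
  refine ⟨hz, ?_⟩
  have hm : Meromorphic (fun z => -2 * f z ^ 3) := fun z =>
    (MeromorphicAt.const (-2) z).mul ((hf z).pow 3)
  have hc : ContinuousAt (fun z => -2 * f z ^ 3) z := by
    have := hz.continuousAt; fun_prop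
  exact (hz.deriv.deriv.continuousAt.eventuallyEq_nhds_iff_eventuallyEq_nhdsNE hc).1
    (hf.deriv.deriv.meromorphicOn.eventuallyEq_nhdsNE hm.meromorphicOn isPreconnected_univ
      (mem_univ a) (mem_univ z) ha.2)

theorem DifferentiableAt.conj_comp_conj {f : ℂ → ℂ} {z : ℂ}
    (hf : DifferentiableAt ℂ f (starRingEnd ℂ z)) :
    DifferentiableAt ℂ (fun z => starRingEnd ℂ (f (starRingEnd ℂ z))) z := by
  have := hf.conj_conj
  simp only [Complex.conj_conj] at this
  exact this

theorem deriv_conj_comp_conj (f : ℂ → ℂ) (z : ℂ) :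
    deriv (fun z => starRingEnd ℂ (f (starRingEnd ℂ z))) z =
      starRingEnd ℂ (deriv f (starRingEnd ℂ z)) :=
  congrFun (deriv_conj_conj (f := f)) z

theorem AnalyticAt.conj_conj {f : ℂ → ℂ} {z : ℂ} (hf : AnalyticAt ℂ f (starRingEnd ℂ z)) :
    AnalyticAt ℂ (fun z => starRingEnd ℂ (f (starRingEnd ℂ z))) z := by
  rw [Complex.analyticAt_iff_eventually_differentiableAt] at hf ⊢
  filter_upwards [Complex.continuous_conj.continuousAt.eventually hf] with w hw
    using hw.conj_comp_conj

theorem Meromorphic.conj_conj {f : ℂ → ℂ} (hf : Meromorphic f) :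
    Meromorphic (fun z => starRingEnd ℂ (f (starRingEnd ℂ z))) := by
  intro z
  obtain ⟨n, hn⟩ := hf (starRingEnd ℂ z)
  refine ⟨n, hn.conj_conj.congr (.of_forall fun w => ?_)⟩
  simp

/-! ### Symmetries of `S` and its behaviour on the real axis. -/

namespace IsSl

variable {S : ℂ → ℂ}

theorem meromorphic (h : IsSl S) : Meromorphic S := fun z => (h.nf (mem_univ z)).meromorphicAt

theorem solvesAt (h : IsSl S) {z : ℂ} (hz : AnalyticAt ℂ S z) : SolvesAt S z :=
  h.meromorphic.solvesAt h.solves hz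

theorem deriv_sq (h : IsSl S) {z : ℂ} (hz : AnalyticAt ℂ S z) :
    deriv S z ^ 2 = 1 - S z ^ 4 := by
  have h1 : (deriv S ^ 2 : ℂ → ℂ) =ᶠ[𝓝[≠] z] 1 - S ^ 4 := by
    refine h.meromorphic.deriv.pow.meromorphicOn.eventuallyEq_nhdsNE (a := 0)
      ((Meromorphic.const 1).sub h.meromorphic.pow).meromorphicOn isPreconnected_univ
      (mem_univ _) (mem_univ z) ?_
    filter_upwards [h.solves.first_integral (by simp [h.map_zero, h.deriv_zero])] with w hw
    simpa using hw
  exact eq_of_eventuallyEq_nhdsNE (hz.deriv.pow 2).continuousAt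
    (analyticAt_const.sub (hz.pow 4)).continuousAt h1

theorem neg_apply (h : IsSl S) (z : ℂ) : S (-z) = -S z := by
  have h1 := (h.nf.comp_affine (κ := -1) (-1) 0 (by norm_num)).eq_of_solvesAt h.nf (a := 0)
    (SolvesAt.comp_affine (by norm_num) (by simpa using h.solves)) h.solves
    (by simp [h.map_zero]) (by rw [deriv_affine]; simp)
  have := congrFun h1 z
  simp only [neg_mul, one_mul, add_zero] at this
  rw [← this, neg_neg]

theorem I_mul_apply (h : IsSl S) (z : ℂ) : S (Complex.I * z) = Complex.I * S z := by
  have h1 := (h.nf.comp_affine (κ := -Complex.I) Complex.I 0 (by simp)).eq_of_solvesAt h.nf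
    (a := 0) (SolvesAt.comp_affine (by norm_num) (by simpa using h.solves)) h.solves
    (by simp [h.map_zero]) (by rw [deriv_affine]; simp [← mul_assoc])
  have := congrFun h1 z
  simp only [add_zero] at this
  rw [← this, neg_mul, mul_neg, ← mul_assoc, Complex.I_mul_I]
  ring

theorem analyticAt_I_mul (h : IsSl S) {z : ℂ} (hz : AnalyticAt ℂ S z) :
    AnalyticAt ℂ S (Complex.I * z) := by
  have h1 : S = fun w => Complex.I * S (-Complex.I * w) := by
    funext w
    rw [← h.I_mul_apply]
    congr 1
    rw [← mul_assoc, mul_neg, Complex.I_mul_I]; ring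
  rw [h1]
  refine analyticAt_const.mul
    (AnalyticAt.comp (g := S) (f := fun w => -Complex.I * w) ?_ (by fun_prop))
  rwa [← mul_assoc, neg_mul, Complex.I_mul_I, neg_neg, one_mul]

/-- The equation and the initial data at `0` are real, so conjugating source and target gives a
solution with the same data. -/
theorem conj_eventuallyEq (h : IsSl S) (z : ℂ) :
    (fun z => starRingEnd ℂ (S (starRingEnd ℂ z))) =ᶠ[𝓝[≠] z] S := by
  refine h.meromorphic.conj_conj.meromorphicOn.eventuallyEq_nhdsNE (a := 0)
      h.meromorphic.meromorphicOn isPreconnected_univ (mem_univ _) (mem_univ z) ?_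
  have hd : deriv (fun z => starRingEnd ℂ (S (starRingEnd ℂ z))) =
      fun z => starRingEnd ℂ (deriv S (starRingEnd ℂ z)) :=
    funext (deriv_conj_comp_conj _)
  have hd2 : deriv (fun z => starRingEnd ℂ (deriv S (starRingEnd ℂ z))) =
      fun z => starRingEnd ℂ (deriv (deriv S) (starRingEnd ℂ z)) :=
    funext (deriv_conj_comp_conj _)
  refine SolvesAt.eventuallyEq ⟨AnalyticAt.conj_conj (by simpa using h.solves.1), ?_⟩ h.solves
    (by simp [h.map_zero]) (by simp [hd, h.deriv_zero])
  have hc : Tendsto (starRingEnd ℂ) (𝓝 0) (𝓝 0) := by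
    simpa using Complex.continuous_conj.tendsto 0
  filter_upwards [hc.eventually h.solves.2] with w hw
  rw [hd, hd2]
  simp only [hw, map_mul, map_neg, map_pow, map_ofNat]

theorem conj_ofReal_of_analyticAt (h : IsSl S) {x : ℝ} (hx : AnalyticAt ℂ S x) :
    starRingEnd ℂ (S x) = S x := by
  have := eq_of_eventuallyEq_nhdsNE (AnalyticAt.conj_conj (by simpa using hx)).continuousAt
    hx.continuousAt (h.conj_eventuallyEq x)
  simpa using this

theorem conj_deriv_ofReal_of_analyticAt (h : IsSl S) {x : ℝ} (hx : AnalyticAt ℂ S x) :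
    starRingEnd ℂ (deriv S x) = deriv S x := by
  have h1 := (ContinuousAt.eventuallyEq_nhds_iff_eventuallyEq_nhdsNE
    (AnalyticAt.conj_conj (z := x) (by simpa using hx)).continuousAt hx.continuousAt).1
    (h.conj_eventuallyEq x)
  have h2 := h1.deriv_eq
  have h3 : deriv (fun z => starRingEnd ℂ (S (starRingEnd ℂ z))) (x : ℂ) =
      starRingEnd ℂ (deriv S (starRingEnd ℂ x)) := deriv_conj_comp_conj _ _
  rw [h3] at h2
  simpa using h2

/-- Both `S x` and `S' x` are real, so `1 - S⁴ = S'² ≥ 0`. -/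
theorem norm_ofReal_le_one_of_analyticAt (h : IsSl S) {x : ℝ} (hx : AnalyticAt ℂ S x) :
    ‖S x‖ ≤ 1 := by
  have h1 := h.deriv_sq hx
  obtain ⟨a, ha⟩ := Complex.conj_eq_iff_real.1 (h.conj_ofReal_of_analyticAt hx)
  obtain ⟨b, hb⟩ := Complex.conj_eq_iff_real.1 (h.conj_deriv_ofReal_of_analyticAt hx)
  rw [ha, hb] at h1
  rw [ha, Complex.norm_real, Real.norm_eq_abs]
  have h2 : b ^ 2 = 1 - a ^ 4 := by exact_mod_cast h1
  by_contra hlt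
  have h3 : 1 < |a| ^ 4 := one_lt_pow₀ (not_le.1 hlt) (by norm_num)
  have h4 : |a| ^ 4 = a ^ 4 := Even.pow_abs ⟨2, rfl⟩ a
  nlinarith [sq_nonneg b]

/-- At a real pole `|S|` would tend to infinity along nearby real points, where `S` is analytic and
hence bounded by `1`. -/
theorem analyticAt_ofReal (h : IsSl S) (x : ℝ) : AnalyticAt ℂ S x := by
  rcases meromorphicNFAt_iff_analyticAt_or.1 (h.nf (mem_univ (x : ℂ))) with hx | ⟨hm, ho, -⟩
  · exact hx
  · exfalso
    have h1 := tendsto_cobounded_of_meromorphicOrderAt_neg ho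
    have h2 : Tendsto (fun t : ℝ => (t : ℂ)) (𝓝[≠] x) (𝓝[≠] (x : ℂ)) := by
      refine tendsto_nhdsWithin_iff.2 ⟨?_, ?_⟩
      · exact Complex.continuous_ofReal.continuousAt.mono_left nhdsWithin_le_nhds
      · filter_upwards [self_mem_nhdsWithin] with t ht
        simpa using ht
    have h3 : ∀ᶠ t : ℝ in 𝓝[≠] x, ‖S t‖ ≤ 1 := by
      filter_upwards [h2.eventually hm.eventually_analyticAt] with t ht
      exact h.norm_ofReal_le_one_of_analyticAt ht
    have h4 := (tendsto_norm_cobounded_atTop.comp (h1.comp h2)).eventually_gt_atTop 1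
    obtain ⟨t, ht1, ht2⟩ := (h3.and h4).exists
    exact absurd ht1 (not_le.2 ht2)

theorem ofReal_re (h : IsSl S) (x : ℝ) : ((S x).re : ℂ) = S x :=
  Complex.conj_eq_iff_re.1 (h.conj_ofReal_of_analyticAt (h.analyticAt_ofReal x))

theorem ofReal_deriv_re (h : IsSl S) (x : ℝ) : ((deriv S x).re : ℂ) = deriv S x :=
  Complex.conj_eq_iff_re.1 (h.conj_deriv_ofReal_of_analyticAt (h.analyticAt_ofReal x))

theorem hasDerivAt_re (h : IsSl S) (x : ℝ) :
    HasDerivAt (fun t : ℝ => (S t).re) (deriv S x).re x :=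
  (h.analyticAt_ofReal x).differentiableAt.hasDerivAt.real_of_complex

theorem hasDerivAt_deriv_re (h : IsSl S) (x : ℝ) :
    HasDerivAt (fun t : ℝ => (deriv S t).re) (-2 * (S x).re ^ 3) x := by
  have := (h.solvesAt (h.analyticAt_ofReal x)).hasDerivAt_deriv.real_of_complex
  rw [← h.ofReal_re] at this
  refine this.congr_deriv ?_
  norm_cast

theorem deriv_re_sq (h : IsSl S) (x : ℝ) : (deriv S x).re ^ 2 = 1 - (S x).re ^ 4 := by
  have := h.deriv_sq (h.analyticAt_ofReal x)
  rw [← h.ofReal_re, ← h.ofReal_deriv_re] at this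
  exact_mod_cast this

theorem re_mem_Icc (h : IsSl S) (x : ℝ) : (S x).re ∈ Icc (-1 : ℝ) 1 := by
  rw [mem_Icc, ← abs_le]
  exact (Complex.abs_re_le_norm _).trans
    (h.norm_ofReal_le_one_of_analyticAt (h.analyticAt_ofReal x))

end IsSl

/-! ### Existence of the quarter period. -/

/-- `L` is the first positive real at which `S` takes the value `1`. -/
structure IsQuarterPeriod (S : ℂ → ℂ) (L : ℝ) : Prop where
  mem_Icc : L ∈ Icc 1 (Real.pi / 2)
  apply_eq_one : S L = 1
  re_mem_Ico : ∀ t ∈ Ico 0 L, (S t).re ∈ Ico (0 : ℝ) 1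

namespace IsSl

variable {S : ℂ → ℂ}

theorem continuous_re (h : IsSl S) : Continuous fun t : ℝ => (S t).re :=
  continuous_iff_continuousAt.2 fun t => (h.hasDerivAt_re t).continuousAt

theorem continuous_deriv_re (h : IsSl S) : Continuous fun t : ℝ => (deriv S t).re :=
  continuous_iff_continuousAt.2 fun t => (h.hasDerivAt_deriv_re t).continuousAt

theorem re_nonneg_of_deriv_re_nonneg (h : IsSl S) {b : ℝ} (hb : 0 ≤ b)
    (hd : ∀ t ∈ Ioo 0 b, 0 ≤ (deriv S t).re) : 0 ≤ (S b).re := by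
  have hmono : MonotoneOn (fun t : ℝ => (S t).re) (Icc 0 b) := by
    refine monotoneOn_of_deriv_nonneg (convex_Icc 0 b) h.continuous_re.continuousOn
      (fun t _ => (h.hasDerivAt_re t).differentiableAt.differentiableWithinAt) fun t ht => ?_
    rw [interior_Icc] at ht
    rw [(h.hasDerivAt_re t).deriv]
    exact hd t ht
  have := hmono (left_mem_Icc.2 hb) (right_mem_Icc.2 hb) hb
  simpa [h.map_zero] using this

/-- `S'` starts at `1`. Up to its first zero `S` increases from `0`, so at that zero `S ≥ 0` and `S⁴
= 1`, which forces the excluded value `1`. -/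
theorem deriv_re_pos (h : IsSl S) {b : ℝ} (hne : ∀ t ∈ Icc 0 b, (S t).re ≠ 1) :
    ∀ t ∈ Icc 0 b, 0 < (deriv S t).re := by
  by_contra! hcon
  obtain ⟨t, ht, hle⟩ := hcon
  have hK : IsCompact {x ∈ Icc 0 b | (deriv S x).re = 0} :=
    isCompact_Icc.inter_right (isClosed_eq h.continuous_deriv_re continuous_const)
  have h0 : (deriv S ((0 : ℝ) : ℂ)).re = 1 := by simp [h.deriv_zero]
  have hKne : {x ∈ Icc 0 b | (deriv S x).re = 0}.Nonempty := by
    obtain ⟨x, hx, hx0⟩ := intermediate_value_Icc' ht.1 h.continuous_deriv_re.continuousOn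
      (show (0 : ℝ) ∈ Icc (deriv S (t : ℂ)).re (deriv S ((0 : ℝ) : ℂ)).re from
        ⟨hle, by rw [h0]; exact zero_le_one⟩)
    exact ⟨x, ⟨hx.1, hx.2.trans ht.2⟩, hx0⟩
  obtain ⟨x, ⟨hx, hx0⟩, hmin⟩ := hK.exists_isLeast hKne
  have hpos : 0 ≤ (S x).re := by
    refine h.re_nonneg_of_deriv_re_nonneg hx.1 fun y hy => ?_
    by_contra! hneg
    obtain ⟨w, hw, hw0⟩ := intermediate_value_Icc' hy.1.le h.continuous_deriv_re.continuousOn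
      (show (0 : ℝ) ∈ Icc (deriv S (y : ℂ)).re (deriv S ((0 : ℝ) : ℂ)).re from
        ⟨hneg.le, by rw [h0]; exact zero_le_one⟩)
    have := hmin ⟨⟨hw.1, hw.2.trans (hy.2.le.trans hx.2)⟩, hw0⟩
    linarith [hw.2, hy.2]
  have h1 := h.deriv_re_sq x
  rw [hx0] at h1
  exact hne x hx ((pow_eq_one_iff_of_nonneg hpos (by norm_num : (4 : ℕ) ≠ 0)).1 (by linarith))

/-- Otherwise `0 ≤ S < 1` and `S' = √(1 - S⁴) ≥ √(1 - S²)` on the interval, so `arcsin S(t) - t` is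
nondecreasing; at `π/2` this yields `S ≥ 1`. -/
theorem exists_re_eq_one (h : IsSl S) : ∃ t ∈ Icc 0 (Real.pi / 2), (S (t : ℝ)).re = 1 := by
  by_contra! hne
  have hpos := h.deriv_re_pos hne
  have hpi : (0 : ℝ) ≤ Real.pi / 2 := by positivity
  have hlt : ∀ t ∈ Icc 0 (Real.pi / 2), (S (t : ℝ)).re < 1 := fun t ht =>
    lt_of_le_of_ne (h.re_mem_Icc t).2 (hne t ht)
  have hnn : ∀ t ∈ Icc 0 (Real.pi / 2), 0 ≤ (S (t : ℝ)).re := fun t ht =>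
    h.re_nonneg_of_deriv_re_nonneg ht.1 fun y hy =>
      (hpos y ⟨hy.1.le, hy.2.le.trans ht.2⟩).le
  have hd : ∀ t ∈ Icc 0 (Real.pi / 2), HasDerivAt
      (fun t : ℝ => Real.arcsin (S t).re - t)
      (1 / √(1 - (S t).re ^ 2) * (deriv S t).re - 1) t := fun t ht => by
    have h1 : HasDerivAt (fun t : ℝ => Real.arcsin (S t).re)
        (1 / √(1 - (S t).re ^ 2) * (deriv S t).re) t :=
      HasDerivAt.comp (h₂ := Real.arcsin) (h := fun t : ℝ => (S t).re) t
        (Real.hasDerivAt_arcsin (by linarith [hnn t ht]) (hne t ht)) (h.hasDerivAt_re t)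
    exact h1.sub (hasDerivAt_id' t)
  have hmono : MonotoneOn (fun t : ℝ => Real.arcsin (S t).re - t) (Icc 0 (Real.pi / 2)) := by
    refine monotoneOn_of_deriv_nonneg (convex_Icc _ _)
      (fun t ht => (hd t ht).continuousAt.continuousWithinAt)
      (fun t ht => (hd t (interior_subset ht)).differentiableAt.differentiableWithinAt)
      fun t ht => ?_
    have ht' := interior_subset ht
    rw [(hd t ht').deriv]
    have h1 := hlt t ht'
    have h2 := hnn t ht'
    have h3 : 0 < 1 - (S t).re ^ 2 := by nlinarith
    have h4 : √(1 - (S t).re ^ 2) ≤ (deriv S t).re := by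
      rw [Real.sqrt_le_left (hpos t ht').le, h.deriv_re_sq]
      nlinarith [sq_nonneg (S t).re]
    rw [sub_nonneg, one_div, inv_mul_eq_div, one_le_div (Real.sqrt_pos.2 h3)]
    exact h4
  have h5 := hmono (left_mem_Icc.2 hpi) (right_mem_Icc.2 hpi) hpi
  simp only [Complex.ofReal_zero, h.map_zero, Complex.zero_re, Real.arcsin_zero, sub_zero] at h5
  have h6 : Real.pi / 2 ≤ Real.arcsin (S ((Real.pi / 2 : ℝ) : ℂ)).re := by linarith
  rw [Real.pi_div_two_le_arcsin] at h6
  exact absurd h6 (not_le.2 (hlt _ (right_mem_Icc.2 hpi)))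

theorem exists_isQuarterPeriod (h : IsSl S) : ∃ L, IsQuarterPeriod S L := by
  obtain ⟨t, ht, ht1⟩ := h.exists_re_eq_one
  have hK : IsCompact {x ∈ Icc 0 (Real.pi / 2) | (S (x : ℝ)).re = 1} :=
    isCompact_Icc.inter_right (isClosed_eq h.continuous_re continuous_const)
  obtain ⟨L, ⟨hL, hL1⟩, hmin⟩ := hK.exists_isLeast ⟨t, ht, ht1⟩
  refine ⟨L, ⟨?_, hL.2⟩, by rw [← h.ofReal_re, hL1, Complex.ofReal_one], fun x hx => ?_⟩
  -- Since `|S'| ≤ 1` on the reals, `S` needs at least unit time to climb from `0` to `1`. The bound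
  -- `1 ≤ L` later keeps the poles out of the disc.
  · have := (convex_univ (𝕜 := ℝ)).norm_image_sub_le_of_norm_hasDerivWithin_le (C := 1)
      (fun x _ => (h.hasDerivAt_re x).hasDerivWithinAt) (fun x _ => ?_) (mem_univ 0) (mem_univ L)
    · simp only [hL1, Complex.ofReal_zero, h.map_zero, Complex.zero_re, sub_zero, norm_one,
        one_mul, Real.norm_of_nonneg hL.1] at this
      exact this
    · rw [Real.norm_eq_abs, abs_le_one_iff_mul_self_le_one, ← sq, h.deriv_re_sq]
      have : 0 ≤ (S x).re ^ 4 := by positivity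
      linarith
  · have hne : ∀ y ∈ Icc 0 x, (S (y : ℝ)).re ≠ 1 := fun y hy hy1 => by
      have := hmin ⟨⟨hy.1, hy.2.trans (hx.2.le.trans hL.2)⟩, hy1⟩
      linarith [hy.2, hx.2]
    refine ⟨h.re_nonneg_of_deriv_re_nonneg hx.1 fun y hy =>
      (h.deriv_re_pos hne y ⟨hy.1.le, hy.2.le⟩).le, lt_of_le_of_ne (h.re_mem_Icc x).2
      (hne x ⟨hx.1, le_rfl⟩)⟩

end IsSl

/-! ### Reflection at `L` and the periods. -/

namespace IsQuarterPeriod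

variable {S : ℂ → ℂ} {L : ℝ}

theorem pos (hL : IsQuarterPeriod S L) : 0 < L := zero_lt_one.trans_le hL.mem_Icc.1

theorem deriv_eq_zero (hL : IsQuarterPeriod S L) (h : IsSl S) : deriv S L = 0 := by
  have := h.deriv_sq (h.analyticAt_ofReal L)
  rw [hL.apply_eq_one] at this
  simpa using this

/-- Because `S'(L) = 0`, `S` and its reflection about `L` have the same value and derivative at `L`.
-/
theorem reflect (hL : IsQuarterPeriod S L) (h : IsSl S) (z : ℂ) : S (2 * L - z) = S z := by
  have hs := h.solvesAt (h.analyticAt_ofReal L)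
  have e : (-1 : ℂ) * L + 2 * L = L := by ring
  have h1 := (h.nf.comp_affine (κ := 1) (-1) (2 * L) (by norm_num)).eq_of_solvesAt h.nf (a := L)
    (SolvesAt.comp_affine (by norm_num) (by rwa [e])) hs
    (by rw [e, one_mul]) (by rw [deriv_affine, e, hL.deriv_eq_zero h]; simp)
  rw [← congrFun h1 z, one_mul]
  congr 1; ring

theorem antiperiodic (hL : IsQuarterPeriod S L) (h : IsSl S) :
    Function.Antiperiodic S (2 * L) := fun z => by
  rw [← h.neg_apply, ← hL.reflect h]
  congr 1; ring

theorem antiperiodic_I (hL : IsQuarterPeriod S L) (h : IsSl S) :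
    Function.Antiperiodic S (2 * Complex.I * L) := fun z => by
  have e : z + 2 * Complex.I * L = Complex.I * (-Complex.I * z + 2 * L) := by
    linear_combination z * Complex.I_mul_I
  rw [e, h.I_mul_apply, hL.antiperiodic h, mul_neg, ← h.I_mul_apply, ← mul_assoc, mul_neg,
    Complex.I_mul_I, neg_neg, one_mul]

/-- `S²` is even with period `2L`, so `x` may be shifted into `[-L, L)`. As `0 ≤ S < 1` on `[0, L)`,
only the endpoint `-L` remains. -/
theorem exists_of_sq_eq_one (hL : IsQuarterPeriod S L) (h : IsSl S) {x : ℝ}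
    (hx : S x ^ 2 = 1) : ∃ k : ℤ, x = (2 * k + 1) * L := by
  have hL0 := hL.pos
  set k : ℤ := ⌊(x + L) / (2 * L)⌋ with hk
  have h1 : (k : ℝ) * (2 * L) ≤ x + L := (le_div_iff₀ (by positivity)).1 (Int.floor_le _)
  have h2 : x + L < (k + 1) * (2 * L) := (div_lt_iff₀ (by positivity)).1 (Int.lt_floor_add_one _)
  have hper : Function.Periodic (fun z => S z ^ 2) (2 * L) := fun z => by
    simp only [hL.antiperiodic h z, neg_sq]
  have h3 : S ((x - k * (2 * L) : ℝ) : ℂ) ^ 2 = 1 := by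
    rw [← hx]
    have := hper.sub_int_mul_eq k (x := (x : ℂ))
    rw [← this]
    push_cast
    rfl
  have hlt : ∀ t ∈ Ico 0 L, S t ^ 2 ≠ 1 := by
    intro t ht h4
    rw [← h.ofReal_re] at h4
    have h5 : (S t).re ^ 2 = 1 := by exact_mod_cast h4
    have h6 := hL.re_mem_Ico t ht
    nlinarith [h6.1, h6.2]
  rcases le_or_gt 0 (x - k * (2 * L)) with h4 | h4
  · exact absurd h3 (hlt _ ⟨h4, by linarith⟩)
  · have h5 : S ((-(x - k * (2 * L)) : ℝ) : ℂ) ^ 2 = 1 := by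
      rw [Complex.ofReal_neg, h.neg_apply, neg_sq, h3]
    have h6 : L ≤ -(x - k * (2 * L)) := by
      by_contra! h7
      exact hlt _ ⟨by linarith, h7⟩ h5
    refine ⟨k - 1, ?_⟩
    push_cast
    linarith

end IsQuarterPeriod

/-! ### Addition formula. -/

namespace IsSl

variable {S : ℂ → ℂ}

/-- The addition formula of the lemniscatic sine. -/
theorem add_eventuallyEq (h : IsSl S) {a : ℂ} (ha : AnalyticAt ℂ S a) (z : ℂ) :
    (fun w => S (w + a)) =ᶠ[𝓝[≠] z]
      fun w => (S a * deriv S w + deriv S a * S w) / (1 + S a ^ 2 * S w ^ 2) := by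
  have hq := h.deriv_sq ha
  set p := S a with hp
  set q := deriv S a with hqd
  have hne : ∀ᶠ w in 𝓝 (0 : ℂ), 1 + p ^ 2 * S w ^ 2 ≠ 0 := by
    have : ContinuousAt (fun w => 1 + p ^ 2 * S w ^ 2) 0 := by
      have := h.solves.1.continuousAt; fun_prop
    exact this.eventually_ne (by simp [h.map_zero])
  have hI := h.solves.1.eventually_analyticAt.mono fun w hw => h.deriv_sq hw
  -- The right-hand side is checked to solve the equation in `w`, using the first integral at `w`
  -- and at `a`; both sides have the data `S a`, `S' a` at `0`.
  have hd1 : ∀ᶠ w in 𝓝 (0 : ℂ), HasDerivAt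
      (fun w => (p * deriv S w + q * S w) / (1 + p ^ 2 * S w ^ 2))
      ((deriv S w * q * (1 - p ^ 2 * S w ^ 2) - 2 * p * S w * (p ^ 2 + S w ^ 2)) /
        (1 + p ^ 2 * S w ^ 2) ^ 2) w := by
    filter_upwards [h.solves.eventually, hI, hne] with w hw hI hne
    refine (((hw.hasDerivAt_deriv.const_mul p).add (hw.hasDerivAt.const_mul q)).div
      (((hw.hasDerivAt.fun_pow 2).const_mul (p ^ 2)).const_add 1) hne).congr_deriv ?_
    congr 1
    simp only [Nat.cast_ofNat, Pi.add_apply]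
    norm_num
    linear_combination (-2 * p ^ 3 * S w) * hI
  have hd2 : ∀ᶠ w in 𝓝 (0 : ℂ), HasDerivAt
      (fun w => (deriv S w * q * (1 - p ^ 2 * S w ^ 2) - 2 * p * S w * (p ^ 2 + S w ^ 2)) /
        (1 + p ^ 2 * S w ^ 2) ^ 2)
      (-2 * ((p * deriv S w + q * S w) / (1 + p ^ 2 * S w ^ 2)) ^ 3) w := by
    filter_upwards [h.solves.eventually, hI, hne] with w hw hI hne
    refine ((((hw.hasDerivAt_deriv.mul_const q).mul
      (((hw.hasDerivAt.fun_pow 2).const_mul (p ^ 2)).const_sub 1)).sub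
      ((hw.hasDerivAt.const_mul (2 * p)).mul ((hw.hasDerivAt.fun_pow 2).const_add (p ^ 2)))).div
      ((((hw.hasDerivAt.fun_pow 2).const_mul (p ^ 2)).const_add 1).fun_pow 2)
      (pow_ne_zero 2 hne)).congr_deriv ?_
    simp only [Nat.cast_ofNat, Pi.sub_apply, Pi.mul_apply]
    rw [div_pow, ← mul_div_assoc, div_eq_div_iff (pow_ne_zero 2 (pow_ne_zero 2 hne))
      (pow_ne_zero 3 hne)]
    norm_num
    linear_combination (1 + p ^ 2 * S w ^ 2) ^ 4 *
      ((2 * p ^ 4 * S w ^ 3 * q + 2 * p ^ 3 * deriv S w) * hI +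
      (6 * p * deriv S w * S w ^ 2 + 2 * S w ^ 3 * q) * hq)
  have hG := SolvesAt.of_hasDerivAt hd1 hd2
  have hsh : SolvesAt (fun w => S (w + a)) 0 := by
    have := SolvesAt.comp_affine (f := S) (a := 0) (κ := 1) (μ := 1) (b := a) rfl
      (by simpa using h.solvesAt ha)
    simpa using this
  have h0 := hsh.eventuallyEq hG (by simp [h.map_zero, h.deriv_zero, hp])
    (by rw [hd1.self_of_nhds.deriv, deriv_comp_add_const]; simp [h.map_zero, h.deriv_zero, hqd])
  refine MeromorphicOn.eventuallyEq_nhdsNE (U := univ) (fun w _ => ?_) (fun w _ => ?_)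
    isPreconnected_univ (mem_univ _) (mem_univ z) h0
  · exact MeromorphicAt.comp_analyticAt (g := fun w => w + a) (h.meromorphic (w + a))
      (by fun_prop)
  · have h1 := h.meromorphic w
    have h2 := h1.deriv
    exact (((MeromorphicAt.const p w).mul h2).add ((MeromorphicAt.const q w).mul h1)).div
      ((MeromorphicAt.const 1 w).add ((MeromorphicAt.const (p ^ 2) w).mul (h1.pow 2)))

theorem analyticAt_add (h : IsSl S) {a z : ℂ} (ha : AnalyticAt ℂ S a) (hz : AnalyticAt ℂ S z)
    (hne : 1 + S a ^ 2 * S z ^ 2 ≠ 0) : AnalyticAt ℂ S (z + a) := by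
  rw [← (h.nf (mem_univ (z + a))).meromorphicOrderAt_nonneg_iff_analyticAt,
    ← meromorphicOrderAt_comp_add_const_eq_meromorphicOrderAt,
    show S ∘ (fun w => w + a) = fun w => S (w + a) from rfl,
    meromorphicOrderAt_congr (h.add_eventuallyEq ha z)]
  refine AnalyticAt.meromorphicOrderAt_nonneg ?_
  have := hz.deriv
  fun_prop (disch := exact hne)

end IsSl

/-! ### Poles of `S` and the first-order equation. -/

namespace IsQuarterPeriod

variable {S : ℂ → ℂ} {L : ℝ}

/-- With `z = x + iy` the addition formula can fail to give analyticity only if `S(x)² S(y)² = 1`.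
Both factors are at most `1`, so both equal `1`. -/
theorem exists_of_not_analyticAt (hL : IsQuarterPeriod S L) (h : IsSl S) {z : ℂ}
    (hz : ¬AnalyticAt ℂ S z) :
    ∃ m n : ℤ, z = (2 * m + 1) * L + (2 * n + 1) * (Complex.I * L) := by
  have h1 : 1 + S z.re ^ 2 * S (Complex.I * z.im) ^ 2 = 0 := by
    by_contra hne
    refine hz ?_
    have := h.analyticAt_add (h.analyticAt_ofReal z.re)
      (h.analyticAt_I_mul (h.analyticAt_ofReal z.im)) hne
    rwa [add_comm, mul_comm, Complex.re_add_im] at this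
  rw [h.I_mul_apply, ← h.ofReal_re z.re, ← h.ofReal_re z.im, mul_pow, Complex.I_sq] at h1
  have h2 : (S z.re).re ^ 2 * (S z.im).re ^ 2 = 1 := by
    have : (((S z.re).re ^ 2 * (S z.im).re ^ 2 : ℝ) : ℂ) = 1 := by
      push_cast
      linear_combination -h1
    exact_mod_cast this
  have hle : ∀ x : ℝ, (S x).re ^ 2 ≤ 1 := fun x => by
    have := h.re_mem_Icc x
    nlinarith [this.1, this.2]
  have ha := hle z.re
  have hb := hle z.im
  have ha1 : (S z.re).re ^ 2 = 1 := by nlinarith [sq_nonneg (S z.re).re, sq_nonneg (S z.im).re]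
  have hb1 : (S z.im).re ^ 2 = 1 := by nlinarith [sq_nonneg (S z.re).re, sq_nonneg (S z.im).re]
  obtain ⟨m, hm⟩ := hL.exists_of_sq_eq_one h (x := z.re)
    (by rw [← h.ofReal_re]; exact_mod_cast ha1)
  obtain ⟨n, hn⟩ := hL.exists_of_sq_eq_one h (x := z.im)
    (by rw [← h.ofReal_re]; exact_mod_cast hb1)
  refine ⟨m, n, ?_⟩
  rw [← Complex.re_add_im z, hm, hn]
  push_cast
  ring

theorem add_quarter_eventuallyEq (hL : IsQuarterPeriod S L) (h : IsSl S) (z : ℂ) :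
    (fun w => S (w + L)) =ᶠ[𝓝[≠] z] fun w => deriv S w / (1 + S w ^ 2) := by
  filter_upwards [h.add_eventuallyEq (h.analyticAt_ofReal L) z] with w hw
  rw [hw, hL.apply_eq_one, hL.deriv_eq_zero h]
  simp

/-- Squaring `S(w + L) = S' / (1 + S²)` gives `S(w + L)² (1 + S²) = 1 - S²`. Were `S` analytic at
`iL + L`, letting `w → iL`, where `S = i`, would give `0 = 2`. -/
theorem not_analyticAt_one_add_I (hL : IsQuarterPeriod S L) (h : IsSl S) :
    ¬AnalyticAt ℂ S (Complex.I * L + L) := by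
  intro hcon
  have hI : AnalyticAt ℂ S (Complex.I * L) := h.analyticAt_I_mul (h.analyticAt_ofReal L)
  have hSI : S (Complex.I * L) = Complex.I := by rw [h.I_mul_apply, hL.apply_eq_one, mul_one]
  -- `S''(iL) = -2 i³ ≠ 0`, so `S'` has no zeros in a punctured neighbourhood; this excludes `1 + S²
  -- = 0` and permits the cancellation.
  have hd : ∀ᶠ w in 𝓝[≠] (Complex.I * L), deriv S w ≠ 0 := by
    refine (h.solvesAt hI).hasDerivAt_deriv.eventually_ne ?_
    rw [hSI]
    simp
  have hA : AnalyticAt ℂ (fun w => S (w + L)) (Complex.I * L) :=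
    AnalyticAt.comp (g := S) (f := fun w => w + (L : ℂ)) hcon (by fun_prop)
  have h1 : (fun w => S (w + L) ^ 2 * (1 + S w ^ 2)) =ᶠ[𝓝[≠] (Complex.I * L)]
      fun w => 1 - S w ^ 2 := by
    filter_upwards [hd, hL.add_quarter_eventuallyEq h (Complex.I * L),
      hI.eventually_analyticAt.filter_mono nhdsWithin_le_nhds] with w hw1 hw2 hw3
    have h2 := h.deriv_sq hw3
    have h3 : 1 + S w ^ 2 ≠ 0 := by
      intro h0
      refine hw1 (pow_eq_zero_iff (two_ne_zero) |>.1 ?_)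
      linear_combination h2 + (1 - S w ^ 2) * h0
    rw [hw2]
    field_simp
    linear_combination h2
  have h2 := eq_of_eventuallyEq_nhdsNE
    ((hA.pow 2).mul (analyticAt_const.add (hI.pow 2))).continuousAt
    (analyticAt_const.sub (hI.pow 2)).continuousAt h1
  norm_num [hSI] at h2

theorem not_analyticAt (hL : IsQuarterPeriod S L) (h : IsSl S) (m n : ℤ) :
    ¬AnalyticAt ℂ S ((2 * m + 1) * L + (2 * n + 1) * (Complex.I * L)) := by
  have hper : ∀ {c : ℂ}, Function.Antiperiodic S c →
      Function.Periodic (meromorphicOrderAt S) c := by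
    intro c hc z
    rw [← meromorphicOrderAt_comp_add_const_eq_meromorphicOrderAt,
      show S ∘ (fun w => w + c) = -S from funext hc, ← meromorphicOrderAt_neg]
  rw [← (h.nf (mem_univ _)).meromorphicOrderAt_nonneg_iff_analyticAt]
  have e : ((2 * m + 1) * L + (2 * n + 1) * (Complex.I * L) : ℂ) =
      (Complex.I * L + L) + m * (2 * L) + n * (2 * Complex.I * L) := by ring
  rw [e, (hper (hL.antiperiodic_I h)).int_mul n, (hper (hL.antiperiodic h)).int_mul m,
    (h.nf (mem_univ _)).meromorphicOrderAt_nonneg_iff_analyticAt]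
  exact hL.not_analyticAt_one_add_I h

/-- By reflection `S(L - w) = S(L + w)`, which the addition formula at `L` equates with `S' / (1 +
S²)`; the identity theorem carries this from `0` to `z`. -/
theorem deriv_eq (hL : IsQuarterPeriod S L) (h : IsSl S) {z : ℂ} (hz : AnalyticAt ℂ S z)
    (hz' : AnalyticAt ℂ S (L - z)) : deriv S z = S (L - z) * (1 + S z ^ 2) := by
  have hA : AnalyticAt ℂ (fun w => S (L - w)) z :=
    AnalyticAt.comp (g := S) (f := fun w => (L : ℂ) - w) hz' (by fun_prop)
  refine eq_of_eventuallyEq_nhdsNE hz.deriv.continuousAt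
    (hA.mul (analyticAt_const.add (hz.pow 2))).continuousAt (f := deriv S)
    (g := fun z => S (L - z) * (1 + S z ^ 2)) ?_
  refine h.meromorphic.deriv.meromorphicOn.eventuallyEq_nhdsNE (a := 0) (U := univ)
    (fun w _ => ?_) isPreconnected_univ (mem_univ _) (mem_univ z) ?_
  · have h1 := h.meromorphic w
    exact (MeromorphicAt.comp_analyticAt (g := fun w => (L : ℂ) - w) (h.meromorphic _)
      (by fun_prop)).mul ((MeromorphicAt.const 1 w).add (h1.pow 2))
  · have hL0 : AnalyticAt ℂ S (0 + L) := by simpa using h.analyticAt_ofReal L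
    have hA0 : ContinuousAt (fun w => S (w + L)) 0 :=
      (AnalyticAt.comp (g := S) (f := fun w => w + (L : ℂ)) hL0 (by fun_prop)).continuousAt
    have hne : 1 + S 0 ^ 2 ≠ 0 := by simp [h.map_zero]
    have hc1 := h.solves.1.continuousAt
    have hc2 := h.solves.1.deriv.continuousAt
    have hev := (hA0.eventuallyEq_nhds_iff_eventuallyEq_nhdsNE
      (g := fun w => deriv S w / (1 + S w ^ 2)) (by fun_prop (disch := exact hne))).1
      (hL.add_quarter_eventuallyEq h 0)
    have hne' := ContinuousAt.eventually_ne (g := fun w => 1 + S w ^ 2) (by fun_prop) hne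
    filter_upwards [hev, hne'] with w hw hw'
    have e : S (L - w) = S (w + L) := by
      rw [← hL.reflect h]
      congr 1; ring
    rw [e, hw]
    field_simp

end IsQuarterPeriod

/-! ### From the first-order system to the second-order equation. -/

theorem isOpen_lemniscaticDisc : IsOpen lemniscaticDisc := Metric.isOpen_ball

theorem isPreconnected_lemniscaticDisc : IsPreconnected lemniscaticDisc :=
  (convex_ball _ _).isPreconnected

theorem zero_mem_lemniscaticDisc : (0 : ℂ) ∈ lemniscaticDisc :=
  Metric.mem_ball_self (by positivity)

theorem norm_lt_one_of_mem_lemniscaticDisc {z : ℂ} (hz : z ∈ lemniscaticDisc) : ‖z‖ < 1 :=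
  (mem_ball_zero_iff.1 hz).trans
    (Real.rpow_lt_one_of_one_lt_of_neg (by norm_num) (by norm_num))

namespace IsLemniscaticIVPSolution

variable {s c : ℂ → ℂ}

theorem first_integral (h : IsLemniscaticIVPSolution s c) {z : ℂ} (hz : z ∈ lemniscaticDisc) :
    (1 + s z ^ 2) * (1 + c z ^ 2) = 2 := by
  have hder : ∀ z ∈ lemniscaticDisc,
      HasDerivAt (fun z => (1 + s z ^ 2) * (1 + c z ^ 2)) 0 z := by
    intro z hz
    refine ((((h.hasDerivAt_s z hz).fun_pow 2).const_add 1).mul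
      (((h.hasDerivAt_c z hz).fun_pow 2).const_add 1)).congr_deriv ?_
    simp only [Nat.cast_ofNat]
    ring
  have := isOpen_lemniscaticDisc.is_const_of_deriv_eq_zero isPreconnected_lemniscaticDisc
    (fun w hw => (hder w hw).differentiableAt.differentiableWithinAt)
    (fun w hw => (hder w hw).deriv) hz zero_mem_lemniscaticDisc
  simp only [h.s_zero, h.c_zero] at this
  rw [this]; norm_num

theorem solvesAt_s (h : IsLemniscaticIVPSolution s c) {z : ℂ} (hz : z ∈ lemniscaticDisc) :
    SolvesAt s z := by
  refine SolvesAt.of_hasDerivAt (f' := fun z => c z * (1 + s z ^ 2)) ?_ ?_ <;>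
    filter_upwards [isOpen_lemniscaticDisc.mem_nhds hz] with w hw
  · exact h.hasDerivAt_s w hw
  · refine ((h.hasDerivAt_c w hw).mul
      (((h.hasDerivAt_s w hw).fun_pow 2).const_add 1)).congr_deriv ?_
    simp only [Nat.cast_ofNat]
    linear_combination s w * h.first_integral hw

theorem solvesAt_c (h : IsLemniscaticIVPSolution s c) {z : ℂ} (hz : z ∈ lemniscaticDisc) :
    SolvesAt c z := by
  refine SolvesAt.of_hasDerivAt (f' := fun z => -s z * (1 + c z ^ 2)) ?_ ?_ <;>
    filter_upwards [isOpen_lemniscaticDisc.mem_nhds hz] with w hw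
  · exact h.hasDerivAt_c w hw
  · refine ((h.hasDerivAt_s w hw).neg.mul
      (((h.hasDerivAt_c w hw).fun_pow 2).const_add 1)).congr_deriv ?_
    simp only [Nat.cast_ofNat, Pi.neg_apply]
    linear_combination c w * h.first_integral hw

theorem deriv_s_zero (h : IsLemniscaticIVPSolution s c) : deriv s 0 = 1 := by
  rw [(h.hasDerivAt_s 0 zero_mem_lemniscaticDisc).deriv, h.s_zero, h.c_zero]
  norm_num

theorem deriv_c_zero (h : IsLemniscaticIVPSolution s c) : deriv c 0 = 0 := by
  rw [(h.hasDerivAt_c 0 zero_mem_lemniscaticDisc).deriv, h.s_zero]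
  norm_num

theorem isSecondOrderSolutionOn (h : IsLemniscaticIVPSolution s c) :
    IsSecondOrderSolutionOn c lemniscaticDisc where
  differentiableOn _ hz := (h.solvesAt_c hz).1.differentiableAt.differentiableWithinAt
  deriv_deriv _ hz := (h.solvesAt_c hz).2.self_of_nhds
  map_zero := h.c_zero
  deriv_zero := h.deriv_c_zero

end IsLemniscaticIVPSolution

theorem IsSecondOrderSolutionOn.solvesAt {f : ℂ → ℂ} {U : Set ℂ} (h : IsSecondOrderSolutionOn f U)
    (hU : IsOpen U) {z : ℂ} (hz : z ∈ U) : SolvesAt f z :=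
  ⟨h.differentiableOn.analyticAt (hU.mem_nhds hz),
    by filter_upwards [hU.mem_nhds hz] with w hw using h.deriv_deriv w hw⟩

theorem eqOn_lemniscaticDisc_of_solvesAt {f g : ℂ → ℂ} (hf : ∀ z ∈ lemniscaticDisc, SolvesAt f z)
    (hg : ∀ z ∈ lemniscaticDisc, SolvesAt g z) (h0 : f 0 = g 0) (h1 : deriv f 0 = deriv g 0) :
    EqOn f g lemniscaticDisc :=
  MeromorphicNFOn.eqOn (fun z hz => (hf z hz).1.meromorphicNFAt)
    (fun z hz => (hg z hz).1.meromorphicNFAt) isPreconnected_lemniscaticDisc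
    zero_mem_lemniscaticDisc
    ((hf 0 zero_mem_lemniscaticDisc).eventuallyEq (hg 0 zero_mem_lemniscaticDisc) h0 h1)

/-! ### Identification of the solutions, and the cosine `S(L - z)`. -/

namespace IsQuarterPeriod

variable {S : ℂ → ℂ} {L : ℝ}

/-- Poles have imaginary part an odd multiple of `L ≥ 1`, while the disc has radius below `1`.
Bounding the imaginary part serves `z` and `L - z` alike. -/
theorem one_le_abs_im (hL : IsQuarterPeriod S L) (h : IsSl S) {z : ℂ} (hz : ¬AnalyticAt ℂ S z) :
    1 ≤ |z.im| := by
  obtain ⟨m, n, rfl⟩ := hL.exists_of_not_analyticAt h hz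
  have e : ((2 * m + 1) * L + (2 * n + 1) * (Complex.I * L) : ℂ).im = ((2 * n + 1 : ℤ) : ℝ) * L := by
    have : ((2 * m + 1) * L + (2 * n + 1) * (Complex.I * L) : ℂ) =
        (((2 * m + 1) * L : ℝ) : ℂ) + ((((2 * n + 1 : ℤ) : ℝ) * L : ℝ) : ℂ) * Complex.I := by
      push_cast; ring
    rw [this, Complex.add_im, Complex.ofReal_im, Complex.im_ofReal_mul, Complex.I_im,
      mul_one, zero_add]
  have hn : (1 : ℝ) ≤ |((2 * n + 1 : ℤ) : ℝ)| := by
    rw [← Int.cast_abs]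
    exact_mod_cast Int.one_le_abs (by omega)
  rw [e, abs_mul, abs_of_pos hL.pos]
  nlinarith [hL.mem_Icc.1]

theorem analyticAt_of_mem_disc (hL : IsQuarterPeriod S L) (h : IsSl S) {z : ℂ}
    (hz : z ∈ lemniscaticDisc) : AnalyticAt ℂ S z := by
  by_contra hcon
  have h1 := hL.one_le_abs_im h hcon
  have h2 := Complex.abs_im_le_norm z
  linarith [norm_lt_one_of_mem_lemniscaticDisc hz]

theorem analyticAt_sub_of_mem_disc (hL : IsQuarterPeriod S L) (h : IsSl S) {z : ℂ}
    (hz : z ∈ lemniscaticDisc) : AnalyticAt ℂ S (L - z) := by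
  by_contra hcon
  have h1 := hL.one_le_abs_im h hcon
  have h2 := Complex.abs_im_le_norm z
  rw [Complex.sub_im, Complex.ofReal_im, zero_sub, abs_neg] at h1
  linarith [norm_lt_one_of_mem_lemniscaticDisc hz]

theorem hasDerivAt_sub (h : IsSl S) {z : ℂ} (hz : AnalyticAt ℂ S (L - z)) :
    HasDerivAt (fun z => S (L - z)) (-deriv S (L - z)) z := by
  refine (HasDerivAt.comp (h₂ := S) (h := fun z : ℂ => (L : ℂ) - z) z (h.solvesAt hz).hasDerivAt
    ((hasDerivAt_id' z).const_sub (L : ℂ))).congr_deriv ?_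
  rw [mul_neg, mul_one]

theorem solvesAt_sub (h : IsSl S) {z : ℂ} (hz : AnalyticAt ℂ S (L - z)) :
    SolvesAt (fun z => S (L - z)) z := by
  have e : ∀ z : ℂ, (-1 : ℂ) * z + L = L - z := fun z => by ring
  have := SolvesAt.comp_affine (f := S) (κ := 1) (μ := -1) (b := L) (a := z) (by norm_num)
    (by rw [e]; exact h.solvesAt hz)
  simpa only [e, one_mul] using this

theorem meromorphicNFOn_sub (h : IsSl S) (a : ℂ) : MeromorphicNFOn (fun z => S (a - z)) univ := by
  have e : ∀ z : ℂ, (-1 : ℂ) * z + a = a - z := fun z => by ring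
  have := h.nf.comp_affine (-1) a one_ne_zero
  simpa only [e, one_mul] using this

theorem analyticAt_sub_iff {a z : ℂ} :
    AnalyticAt ℂ (fun z => S (a - z)) z ↔ AnalyticAt ℂ S (a - z) := by
  refine analyticAt_comp_iff_of_deriv_ne_zero (g := S) (f := fun z => a - z) (by fun_prop) ?_
  rw [((hasDerivAt_id' z).const_sub a).deriv]
  norm_num

theorem isLemniscaticIVPSolution (hL : IsQuarterPeriod S L) (h : IsSl S) :
    IsLemniscaticIVPSolution S (fun z => S (L - z)) where
  s_zero := h.map_zero
  c_zero := by rw [sub_zero, hL.apply_eq_one]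
  hasDerivAt_s z hz := by
    rw [← hL.deriv_eq h (hL.analyticAt_of_mem_disc h hz) (hL.analyticAt_sub_of_mem_disc h hz)]
    exact (hL.analyticAt_of_mem_disc h hz).differentiableAt.hasDerivAt
  hasDerivAt_c z hz := by
    have h1 := hL.analyticAt_of_mem_disc h hz
    have h2 := hL.analyticAt_sub_of_mem_disc h hz
    refine (hasDerivAt_sub h h2).congr_deriv ?_
    -- The second equation of the system is the first one evaluated at `L - z`.
    rw [hL.deriv_eq h h2 (by rwa [sub_sub_cancel]), sub_sub_cancel, neg_mul]

theorem isFullLemniscaticSine (hL : IsQuarterPeriod S L) (h : IsSl S) :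
    IsFullLemniscaticSine S :=
  ⟨h.nf, S, _, hL.isLemniscaticIVPSolution h, fun _ _ => rfl⟩

theorem eqOn_of_isLemniscaticIVPSolution (hL : IsQuarterPeriod S L) (h : IsSl S) {s₀ c₀ : ℂ → ℂ}
    (h₀ : IsLemniscaticIVPSolution s₀ c₀) :
    EqOn S s₀ lemniscaticDisc ∧ EqOn (fun z => S (L - z)) c₀ lemniscaticDisc := by
  have h1 := hL.isLemniscaticIVPSolution h
  exact ⟨eqOn_lemniscaticDisc_of_solvesAt (fun z hz => h1.solvesAt_s hz)
      (fun z hz => h₀.solvesAt_s hz) (h1.s_zero.trans h₀.s_zero.symm)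
      (h1.deriv_s_zero.trans h₀.deriv_s_zero.symm),
    eqOn_lemniscaticDisc_of_solvesAt (fun z hz => h1.solvesAt_c hz)
      (fun z hz => h₀.solvesAt_c hz) (h1.c_zero.trans h₀.c_zero.symm)
      (h1.deriv_c_zero.trans h₀.deriv_c_zero.symm)⟩

theorem eq_of_isFullLemniscaticSine (hL : IsQuarterPeriod S L) (h : IsSl S) {s : ℂ → ℂ}
    (hs : IsFullLemniscaticSine s) : s = S := by
  obtain ⟨s₀, c₀, h₀, he⟩ := hs.extends_ivp
  have h1 : s =ᶠ[𝓝 0] S := by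
    filter_upwards [isOpen_lemniscaticDisc.mem_nhds zero_mem_lemniscaticDisc] with z hz
    rw [he hz, (hL.eqOn_of_isLemniscaticIVPSolution h h₀).1 hz]
  exact funext fun z => hs.meromorphicNFOn.eqOn h.nf isPreconnected_univ (mem_univ _) h1
    (mem_univ z)

/-- Such a `t` is an odd multiple of `L`, and `0 ≤ t ≤ π/2 < 2 < 3L` leaves only `L` itself. -/
theorem eq_of_apply_eq_one (hL : IsQuarterPeriod S L) (h : IsSl S) {t : ℝ}
    (ht : t ∈ Icc 0 (Real.pi / 2)) (ht1 : S t = 1) : t = L := by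
  obtain ⟨k, hk⟩ := hL.exists_of_sq_eq_one h (x := t) (by rw [ht1, one_pow])
  have hL1 := hL.mem_Icc.1
  have hpi := Real.pi_lt_four
  have h1 : ((2 * k + 1 : ℤ) : ℝ) < ((3 : ℤ) : ℝ) := by
    push_cast
    nlinarith [ht.2]
  have h2 : ((-1 : ℤ) : ℝ) < ((2 * k + 1 : ℤ) : ℝ) := by
    push_cast
    nlinarith [ht.1]
  rw [Int.cast_lt] at h1 h2
  have : k = 0 := by omega
  rw [hk, this]
  simp

theorem isPole_sub_iff (h : IsSl S) {a z : ℂ} :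
    IsPole (fun z => S (a - z)) z ↔ ¬AnalyticAt ℂ S (a - z) := by
  rw [IsPole, ← not_le, (meromorphicNFOn_sub h a
    (mem_univ z)).meromorphicOrderAt_nonneg_iff_analyticAt, analyticAt_sub_iff]

theorem isSecondOrderSolutionOn_sub (hL : IsQuarterPeriod S L) (h : IsSl S) {U : Set ℂ}
    (hU : ∀ z ∈ U, AnalyticAt ℂ S (L - z)) :
    IsSecondOrderSolutionOn (fun z => S (L - z)) U where
  differentiableOn z hz :=
    (solvesAt_sub h (hU z hz)).1.differentiableAt.differentiableWithinAt
  deriv_deriv z hz := (solvesAt_sub h (hU z hz)).2.self_of_nhds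
  map_zero := by rw [sub_zero, hL.apply_eq_one]
  deriv_zero := by
    rw [(hasDerivAt_sub h (by simpa using h.analyticAt_ofReal L)).deriv, sub_zero,
      hL.deriv_eq_zero h, neg_zero]

theorem isEllipticWithPeriods_sub (hL : IsQuarterPeriod S L) (h : IsSl S) :
    IsEllipticWithPeriods (fun z => S (L - z)) (4 * (L : ℂ)) (4 * Complex.I * (L : ℂ)) where
  meromorphic z := (meromorphicNFOn_sub h L (mem_univ z)).meromorphicAt
  linearIndependent := by
    have := hL.pos.ne'
    rw [LinearIndependent.pair_iff]
    intro s t hst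
    have hre := congrArg Complex.re hst
    have him := congrArg Complex.im hst
    simp at hre him
    exact ⟨hre.resolve_right this, him.resolve_right this⟩
  periodic₁ z := by
    have := (hL.antiperiodic h).periodic_two_mul
    refine Eq.trans (congrArg S ?_) (this.sub_eq (L - z))
    ring
  periodic₂ z := by
    have := (hL.antiperiodic_I h).periodic_two_mul
    refine Eq.trans (congrArg S ?_) (this.sub_eq (L - z))
    ring

theorem setOf_isPole_sub (hL : IsQuarterPeriod S L) (h : IsSl S) :
    {z : ℂ | IsPole (fun z => S (L - z)) z} =
      {z : ℂ | ∃ p ∈ ({Complex.I * L, -(Complex.I * L), 2 * L + Complex.I * L,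
          2 * L - Complex.I * L} : Set ℂ),
        ∃ m n : ℤ, z = p + m * (4 * L) + n * (4 * Complex.I * L)} := by
  -- The poles form a single family with parameters `m`, `n`; their parities single out the four
  -- classes modulo `4L` and `4iL`.
  have key : ∀ z : ℂ, IsPole (fun z => S (L - z)) z ↔
      ∃ m n : ℤ, z = 2 * m * L + (2 * n + 1) * (Complex.I * L) := by
    intro z
    rw [isPole_sub_iff h]
    constructor
    · intro hz
      obtain ⟨m, n, hmn⟩ := hL.exists_of_not_analyticAt h hz
      refine ⟨-m, -n - 1, ?_⟩
      push_cast
      linear_combination -hmn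
    · rintro ⟨m, n, rfl⟩
      have := hL.not_analyticAt h (-m) (-n - 1)
      have e : (L : ℂ) - (2 * m * L + (2 * n + 1) * (Complex.I * L)) =
          (2 * (-m : ℤ) + 1) * L + (2 * (-n - 1 : ℤ) + 1) * (Complex.I * L) := by
        push_cast
        ring
      rwa [e]
  ext z
  rw [mem_ofPred_eq, key]
  simp only [mem_ofPred_eq, mem_insert_iff, mem_singleton_iff, exists_eq_or_imp, exists_eq_left]
  constructor
  · rintro ⟨m, n, rfl⟩
    rcases Int.even_or_odd' m with ⟨a, rfl | rfl⟩ <;> rcases Int.even_or_odd' n with ⟨b, rfl | rfl⟩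
    · refine .inl ⟨a, b, ?_⟩
      push_cast; ring
    -- For odd `n = 2b + 1` the coefficient `2n + 1 = 4b + 3` equals `4(b + 1) - 1`, hence the shift
    -- and the class of `-iL`.
    · refine .inr (.inl ⟨a, b + 1, ?_⟩)
      push_cast; ring
    · refine .inr (.inr (.inl ⟨a, b, ?_⟩))
      push_cast; ring
    · refine .inr (.inr (.inr ⟨a, b + 1, ?_⟩))
      push_cast; ring
  · rintro (⟨m, n, rfl⟩ | ⟨m, n, rfl⟩ | ⟨m, n, rfl⟩ | ⟨m, n, rfl⟩)
    · exact ⟨2 * m, 2 * n, by push_cast; ring⟩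
    · exact ⟨2 * m, 2 * n - 1, by push_cast; ring⟩
    · exact ⟨2 * m + 1, 2 * n, by push_cast; ring⟩
    · exact ⟨2 * m + 1, 2 * n - 1, by push_cast; ring⟩

end IsQuarterPeriod

theorem mainTheorem2 :
    -- the full lemniscatic sine exists and is unique
    (IsFullLemniscaticSine lemniscaticSine ∧
      ∀ s : ℂ → ℂ, IsFullLemniscaticSine s → s = lemniscaticSine) ∧
    -- the number `L` exists and is unique
    (IsLemniscaticL lemniscaticL ∧ ∀ t : ℝ, IsLemniscaticL t → t = lemniscaticL) ∧
    -- `C(z) = s(L - z)` is meromorphic on the plane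
    MeromorphicNFOn lemniscaticCosine univ ∧
    -- `(s, C)` restricts on the disc to the solution of the initial value problem
    (∀ s₀ c₀ : ℂ → ℂ, IsLemniscaticIVPSolution s₀ c₀ →
      EqOn lemniscaticSine s₀ lemniscaticDisc ∧ EqOn lemniscaticCosine c₀ lemniscaticDisc) ∧
    -- `C` and the original `c` both solve the second-order problem, which has only one solution
    IsSecondOrderSolutionOn lemniscaticCosine {z | ¬ IsPole lemniscaticCosine z} ∧
    IsSecondOrderSolutionOn lemniscaticCosine lemniscaticDisc ∧
    (∀ s₀ c₀ : ℂ → ℂ, IsLemniscaticIVPSolution s₀ c₀ →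
      IsSecondOrderSolutionOn c₀ lemniscaticDisc) ∧
    (∀ f : ℂ → ℂ, IsSecondOrderSolutionOn f lemniscaticDisc →
      EqOn f lemniscaticCosine lemniscaticDisc) ∧
    -- periods
    IsEllipticWithPeriods lemniscaticCosine
      (4 * (lemniscaticL : ℂ)) (4 * Complex.I * (lemniscaticL : ℂ)) ∧
    -- poles
    {z : ℂ | IsPole lemniscaticCosine z} =
      {z : ℂ | ∃ p ∈ ({Complex.I * lemniscaticL, -(Complex.I * lemniscaticL),
          2 * lemniscaticL + Complex.I * lemniscaticL,
          2 * lemniscaticL - Complex.I * lemniscaticL} : Set ℂ),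
        ∃ m n : ℤ, z = p + m * (4 * lemniscaticL) + n * (4 * Complex.I * lemniscaticL)} := by

  obtain ⟨S, h⟩ := exists_isSl
  obtain ⟨L, hL⟩ := h.exists_isQuarterPeriod
  have hfull := hL.isFullLemniscaticSine h
  -- The choice made by `Classical.epsilon` has the defining property because `S` has it, and
  -- uniqueness then identifies it with `S`; the same argument applies to `L`.
  have hsine : lemniscaticSine = S :=
    hL.eq_of_isFullLemniscaticSine h (Classical.epsilon_spec ⟨S, hfull⟩)
  have hisL : IsLemniscaticL L :=
    ⟨⟨hL.pos.le, hL.mem_Icc.2⟩, by rw [hsine, hL.apply_eq_one]⟩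
  have huniq : ∀ t : ℝ, IsLemniscaticL t → t = L := fun t ht =>
    hL.eq_of_apply_eq_one h ht.1 (by rw [← hsine]; exact ht.2)
  have hLeq : lemniscaticL = L := huniq _ (Classical.epsilon_spec ⟨L, hisL⟩)
  have hcos : lemniscaticCosine = fun z => S (L - z) := by
    funext z
    rw [lemniscaticCosine, hsine, hLeq]
  have hdisc := hL.isSecondOrderSolutionOn_sub h
    (fun z hz => hL.analyticAt_sub_of_mem_disc h (z := z) hz)
  rw [hsine, hLeq, hcos]
  refine ⟨⟨hfull, fun s hs => hL.eq_of_isFullLemniscaticSine h hs⟩, ⟨hisL, huniq⟩,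
    IsQuarterPeriod.meromorphicNFOn_sub h L,
    fun s₀ c₀ h₀ => hL.eqOn_of_isLemniscaticIVPSolution h h₀,
    hL.isSecondOrderSolutionOn_sub h fun z hz => ?_, hdisc,
    fun s₀ c₀ h₀ => h₀.isSecondOrderSolutionOn, fun f hf => ?_,
    hL.isEllipticWithPeriods_sub h, hL.setOf_isPole_sub h⟩
  · rw [mem_ofPred_eq, IsQuarterPeriod.isPole_sub_iff h, not_not] at hz
    exact hz
  · exact eqOn_lemniscaticDisc_of_solvesAt (fun z hz => hf.solvesAt isOpen_lemniscaticDisc hz)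
      (fun z hz => hdisc.solvesAt isOpen_lemniscaticDisc hz)
      (hf.map_zero.trans hdisc.map_zero.symm) (hf.deriv_zero.trans hdisc.deriv_zero.symm)
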